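/- Fix an integer $n\ge 0$ and a polynomial $p(t)=at+b\in\mathbb{Z}[t]$ of degree $1$. For a locally Noetherian scheme $S$, let $CM(S)=CM^{p(t)}_{\mathbb{P}^n}(S)$ be the set of isomorphism classes of pairs $(C,i)$ of a flat $S$-scheme $C$ and a finite $S$-morphism $i\colon C\to\mathbb{P}^n_S$ such that for every $s\in S$: (1) the fiber $C_s$ is a Cohen--Macaulay scheme (all its local rings are Cohen--Macaulay) of pure dimension $1$; (2) the induced morphism $i_s\colon C_s\to\mathbb{P}^n_{\kappa(s)}$ is an isomorphism onto its scheme-theoretic image away from a finite set of closed points; (3) the coherent sheaf $(i_s)_*\mathcal{O}_{C_s}$ on $\mathbb{P}^n_{\kappa(s)}$ has Hilbert polynomial $p(t)$. Two pairs $(C_1,i_1)$ and $(C_2,i_2)$ over $S$ are isomorphic if there is an $S$-isomorphism $\alpha\colon C_1\to C_2$ with $i_2\circ\alpha=i_1$. A morphism $T\to S$ acts by base change, $(C,i)\mapsto(C_T,i_T)$ with $C_T=C\times_S T$ and $i_T=i\times\mathrm{id}_T$. Theorem (valuative criterion for separatedness). Let $R$ be a discrete valuation ring with field of fractions $K$.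 Every element $(C,i)\in CM(\operatorname{Spec} R)$ is uniquely determined by its generic fiber $(C_K,i_K)\in CM(\operatorname{Spec} K)$: if $(C,i)$ and $(C',i')$ are elements of $CM(\operatorname{Spec} R)$ and there is a $K$-isomorphism $\alpha_K\colon C_K\to C'_K$ with $i'_K\circ\alpha_K=i_K$, then there is an $R$-isomorphism $\alpha\colon C\to C'$ with $i'\circ\alpha=i$. Equivalently, for every map $\operatorname{Spec} K\to CM$ there is at most one map $\operatorname{Spec} R\to CM$ extending it. -/

import Mathlib

open CategoryTheory CategoryTheory.Limits AlgebraicGeometry TopologicalSpace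

universe u

noncomputable section

namespace CMCurve

/-! ### Projective space -/

/-- The standard grading of `ℤ[x₀, …, xₙ]` by total degree. -/
abbrev grading (n : ℕ) : ℕ → Submodule (ULift.{u} ℤ) (MvPolynomial (Fin (n + 1)) (ULift.{u} ℤ)) :=
  MvPolynomial.homogeneousSubmodule (Fin (n + 1)) (ULift.{u} ℤ)

instance (n : ℕ) : GradedRing (grading.{u} n) := MvPolynomial.gradedAlgebra

/-- The projective space `ℙⁿ_ℤ = Proj ℤ[x₀, …, xₙ]`. -/
abbrev projInt (n : ℕ) : Scheme.{u} := Proj (grading.{u} n)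

/-- The projective space `ℙⁿ_S = S × ℙⁿ_ℤ` over a scheme `S`. -/
abbrev projSpace (n : ℕ) (S : Scheme.{u}) : Scheme.{u} :=
  pullback (terminal.from S) (terminal.from (projInt.{u} n))

/-- The standard open subset `D₊(x_j)` of `ℙⁿ_ℤ`. -/
abbrev stdOpen (n : ℕ) (j : Fin (n + 1)) : (projInt.{u} n).Opens :=
  Proj.basicOpen (grading.{u} n) (MvPolynomial.X j)

/-- The regular function `x_l / x_j` on `D₊(x_j)`. -/
def coordRatio (n : ℕ) (j l : Fin (n + 1)) : Γ(projInt.{u} n, stdOpen.{u} n j) :=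
  (Proj.awayToSection (grading.{u} n) (MvPolynomial.X j)).hom
    (HomogeneousLocalization.Away.mk (grading.{u} n) (d := 1)
      (MvPolynomial.isHomogeneous_X _ j) 1 (MvPolynomial.X l)
      (MvPolynomial.isHomogeneous_X _ l))

/-! ### Pairs `(C, i)` of an `S`-scheme and an `S`-morphism `C ⟶ ℙⁿ_S` -/

/-- Pairs `(C, i)` of an `S`-scheme `C` and an `S`-morphism `i : C ⟶ ℙⁿ_S`. The structure
morphism `C ⟶ S` is the composition of `i` with the projection. Isomorphisms in this category are
isomorphisms `α : C₁ ≅ C₂` with `i₂ ∘ α = i₁`. -/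
abbrev Pair (n : ℕ) (S : Scheme.{u}) := Over (projSpace.{u} n S)

variable {n : ℕ} {S T : Scheme.{u}}

/-- The structure morphism `C ⟶ S` of a pair. -/
abbrev Pair.toBase (P : Pair n S) : P.left ⟶ S := P.hom ≫ pullback.fst _ _

/-- The morphism `C ⟶ ℙⁿ_S ⟶ ℙⁿ_ℤ` of a pair. -/
abbrev Pair.toProjInt (P : Pair n S) : P.left ⟶ projInt.{u} n := P.hom ≫ pullback.snd _ _

/-- The base change `(C_T, i_T)` of a pair `(C, i)` along `f : T ⟶ S`: here `C_T = C ×_S T`, and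
`i_T = i × id_T` is the morphism to `ℙⁿ_T` with components the projection `C_T ⟶ T` and
`C_T ⟶ C ⟶ ℙⁿ_ℤ`. -/
abbrev Pair.baseChange (f : T ⟶ S) (P : Pair n S) : Pair n T :=
  Over.mk (Y := pullback P.toBase f)
    (pullback.lift (pullback.snd P.toBase f) (pullback.fst P.toBase f ≫ P.toProjInt)
      (terminal.hom_ext _ _))

/-- The fiber `(C_s, i_s)` of a pair over a point `s` of the base. -/
abbrev Pair.fiber (P : Pair n S) (s : S) : Pair n (Spec (S.residueField s)) :=
  P.baseChange (S.fromSpecResidueField s)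

/-- The morphism `α_T : C_T ⟶ C'_T` induced by a morphism of pairs `α : (C, i) ⟶ (C', i')`. -/
def Pair.baseChangeMap (f : T ⟶ S) {P Q : Pair n S} (e : P ⟶ Q) :
    P.baseChange f ⟶ Q.baseChange f :=
  Over.homMk (U := P.baseChange f) (V := Q.baseChange f)
    (pullback.map P.toBase f Q.toBase f e.left (𝟙 T) (𝟙 S)
      (by rw [Category.comp_id, Pair.toBase, Over.w_assoc])
      (by rw [Category.comp_id, Category.id_comp]))
    (by
      dsimp only [Pair.baseChange, Over.mk_hom]
      apply pullback.hom_ext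
      · rw [Category.assoc, pullback.lift_fst, pullback.lift_fst, pullback.lift_snd,
          Category.comp_id]
      · rw [Category.assoc, pullback.lift_snd, pullback.lift_snd, pullback.lift_fst_assoc,
          Category.assoc, Over.w_assoc])

lemma Pair.baseChangeMap_fst (f : T ⟶ S) {P Q : Pair n S} (e : P ⟶ Q) :
    (Pair.baseChangeMap f e).left ≫ pullback.fst Q.toBase f = pullback.fst P.toBase f ≫ e.left :=
  pullback.lift_fst _ _ _

lemma Pair.baseChangeMap_snd (f : T ⟶ S) {P Q : Pair n S} (e : P ⟶ Q) :
    (Pair.baseChangeMap f e).left ≫ pullback.snd Q.toBase f = pullback.snd P.toBase f :=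
  (pullback.lift_snd _ _ _).trans (Category.comp_id _)

lemma Pair.baseChangeMap_comp (f : T ⟶ S) {P Q : Pair n S} (e : P ⟶ Q) (e' : Q ⟶ P)
    (h : e ≫ e' = 𝟙 P) : Pair.baseChangeMap f e ≫ Pair.baseChangeMap f e' = 𝟙 _ := by
  have h' : e.left ≫ e'.left = 𝟙 _ := by rw [← Over.comp_left, h, Over.id_left]
  apply Over.OverMorphism.ext
  apply pullback.hom_ext (f := P.toBase) (g := f)
  · rw [Over.comp_left, Category.assoc, Pair.baseChangeMap_fst]
    erw [reassoc_of% (Pair.baseChangeMap_fst f e), h', Category.comp_id]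
  · rw [Over.comp_left, Category.assoc, Pair.baseChangeMap_snd]
    erw [Pair.baseChangeMap_snd f e, Category.id_comp]

/-- Base change takes isomorphic pairs to isomorphic pairs. -/
def Pair.baseChangeIso (f : T ⟶ S) {P Q : Pair n S} (e : P ≅ Q) :
    P.baseChange f ≅ Q.baseChange f where
  hom := Pair.baseChangeMap f e.hom
  inv := Pair.baseChangeMap f e.inv
  hom_inv_id := Pair.baseChangeMap_comp f e.hom e.inv e.hom_inv_id
  inv_hom_id := Pair.baseChangeMap_comp f e.inv e.hom e.inv_hom_id

/-! ### The conditions on the fibers -/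

/-- A Noetherian local ring is Cohen–Macaulay if its depth equals its dimension, that is, if there
is a regular sequence (necessarily in the maximal ideal) whose length is the dimension. -/
def IsCohenMacaulayLocalRing (A : Type u) [CommRing A] [IsLocalRing A] : Prop :=
  IsNoetherianRing A ∧
    ∃ rs : List A, RingTheory.Sequence.IsRegular A rs ∧
      (rs.length : WithBot ℕ∞) = ringKrullDim A

/-- A scheme is Cohen–Macaulay if all its local rings are. -/
def IsCohenMacaulay (X : Scheme.{u}) : Prop :=
  ∀ x : X, IsCohenMacaulayLocalRing (X.presheaf.stalk x)

/-- A topological space has pure dimension `d` if all its irreducible components have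
dimension `d`. -/
def HasPureDimension (X : Type u) [TopologicalSpace X] (d : ℕ) : Prop :=
  ∀ Z ∈ irreducibleComponents X, topologicalKrullDim Z = d

/-- The morphism `f` is an isomorphism onto its (scheme-theoretic) image away from a finite set
of closed points. -/
def IsIsoOntoImageAwayFromFinite {X Y : Scheme.{u}} (f : X ⟶ Y) : Prop :=
  ∃ U : f.image.Opens, (U : Set f.image)ᶜ.Finite ∧ (∀ z : f.image, z ∉ U → IsClosed {z}) ∧
    IsIso (f.toImage ∣_ U)

section HilbertPolynomial

variable {k : CommRingCat.{u}} {X : Scheme.{u}}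

/-- The ring homomorphism `k ⟶ Γ(X, U)` of a `k`-scheme `X`. -/
def scalars (f : X ⟶ Spec k) (U : X.Opens) : k →+* Γ(X, U) :=
  ((Scheme.ΓSpecIso k).inv ≫ f.appTop ≫ X.presheaf.map (homOfLE le_top).op).hom

/-- The `k`-module structure on `Γ(X, U)` for a `k`-scheme `X`. -/
abbrev sectionsModule (f : X ⟶ Spec k) (U : X.Opens) : Module k Γ(X, U) :=
  Module.compHom _ (scalars f U)

/-- For a pair `(C, i)` over a field `k`, the `k`-vector space `H⁰(ℙⁿ_k, (i_* 𝒪_C)(d))`, with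
respect to the trivialisations of `𝒪(d)` on the `D₊(x_j)` by `x_j ^ d`: a global section is a
family of `s_j ∈ Γ(D₊(x_j), i_* 𝒪_C)` such that `s_j x_j ^ d = s_l x_l ^ d`, that is,
`s_j = (x_l / x_j) ^ d s_l`, on `D₊(x_j) ∩ D₊(x_l)`. -/
def Pair.twistedSections (P : Pair n (Spec k)) (d : ℕ) :
    letI (j : Fin (n + 1)) := sectionsModule P.toBase (P.toProjInt ⁻¹ᵁ stdOpen.{u} n j)
    Submodule k (∀ j, Γ(P.left, P.toProjInt ⁻¹ᵁ stdOpen.{u} n j)) :=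
  letI (j : Fin (n + 1)) := sectionsModule P.toBase (P.toProjInt ⁻¹ᵁ stdOpen.{u} n j)
  let U (j : Fin (n + 1)) : P.left.Opens := P.toProjInt ⁻¹ᵁ stdOpen.{u} n j
  let resL (j l : Fin (n + 1)) : Γ(P.left, U j) →+* Γ(P.left, U j ⊓ U l) :=
    (P.left.presheaf.map (homOfLE inf_le_left).op).hom
  let resR (j l : Fin (n + 1)) : Γ(P.left, U l) →+* Γ(P.left, U j ⊓ U l) :=
    (P.left.presheaf.map (homOfLE inf_le_right).op).hom
  let ratio (j l : Fin (n + 1)) : Γ(P.left, U j) :=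
    (P.toProjInt.app (stdOpen.{u} n j)).hom (coordRatio.{u} n j l)
  { carrier := {s | ∀ j l, resL j l (s j) = resL j l (ratio j l) ^ d * resR j l (s l)}
    add_mem' := by
      intro s t hs ht j l
      simp only [Pi.add_apply, map_add, hs j l, ht j l, mul_add]
    zero_mem' := by
      intro j l
      simp only [Pi.zero_apply, map_zero, mul_zero]
    smul_mem' := by
      intro c s hs j l
      have hL : resL j l (scalars P.toBase (U j) c) = scalars P.toBase (U j ⊓ U l) c := by
        simp only [resL, scalars, ← CommRingCat.comp_apply, Category.assoc, ← Functor.map_comp]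
        rfl
      have hR : resR j l (scalars P.toBase (U l) c) = scalars P.toBase (U j ⊓ U l) c := by
        simp only [resR, scalars, ← CommRingCat.comp_apply, Category.assoc, ← Functor.map_comp]
        rfl
      change resL j l (scalars P.toBase (U j) c * s j) =
        resL j l (ratio j l) ^ d * resR j l (scalars P.toBase (U l) c * s l)
      rw [map_mul, hs j l, hL]
      erw [map_mul (resR j l), hR]
      ring }

/-- For a pair `(C, i)` over a field `k` with `i` finite, the coherent sheaf `i_* 𝒪_C` on `ℙⁿ_k`
has Hilbert polynomial `p`: for all large `d`, the `k`-vector space `H⁰(ℙⁿ_k, (i_* 𝒪_C)(d))`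
is of finite dimension `p(d)`. -/
def Pair.HasHilbertPolynomial (P : Pair n (Spec k)) (p : Polynomial ℤ) : Prop :=
  letI (j : Fin (n + 1)) := sectionsModule P.toBase (P.toProjInt ⁻¹ᵁ stdOpen.{u} n j)
  ∀ᶠ d : ℕ in Filter.atTop,
    Module.Finite k (P.twistedSections d) ∧
      (Module.finrank k (P.twistedSections d) : ℤ) = p.eval (d : ℤ)

end HilbertPolynomial

/-! ### The functor of Cohen–Macaulay curves -/

/-- A family of Cohen–Macaulay curves over `S` with Hilbert polynomial `p`: a flat `S`-scheme `C`
with a finite `S`-morphism `i : C ⟶ ℙⁿ_S` such that every fiber `C_s` is Cohen–Macaulay of pure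
dimension `1`, every `i_s` is an isomorphism onto its image away from a finite set of closed
points, and every sheaf `(i_s)_* 𝒪_{C_s}` has Hilbert polynomial `p`. -/
structure IsCMFamily (p : Polynomial ℤ) (P : Pair n S) : Prop where
  flat : Flat P.toBase
  finite : IsFinite P.hom
  cohenMacaulay : ∀ s : S, IsCohenMacaulay (P.fiber s).left
  pureDimension : ∀ s : S, HasPureDimension (P.fiber s).left 1
  isoOntoImage : ∀ s : S, IsIsoOntoImageAwayFromFinite (P.fiber s).hom
  hilbertPolynomial : ∀ s : S, (P.fiber s).HasHilbertPolynomial p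

/-- Isomorphism classes of pairs `(C, i)` over `S`. -/
def PairClass (n : ℕ) (S : Scheme.{u}) : Type (u + 1) :=
  Quotient (isIsomorphicSetoid (Pair.{u} n S))

/-- Base change of isomorphism classes of pairs. -/
def PairClass.baseChange (f : T ⟶ S) : PairClass n S → PairClass n T :=
  Quotient.map' (Pair.baseChange f) fun _ _ ⟨e⟩ ↦ ⟨Pair.baseChangeIso f e⟩

/-- `CM(S)`: the set of isomorphism classes of families `(C, i)` of Cohen–Macaulay curves over `S`
with Hilbert polynomial `p`. -/
def CM (n : ℕ) (p : Polynomial ℤ) (S : Scheme.{u}) : Set (PairClass n S) :=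
  {x | ∃ P : Pair n S, IsCMFamily p P ∧ Quotient.mk'' P = x}

end CMCurve

end

noncomputable section

namespace CMCurve

/-- Nakayama's lemma for generation by `1`: if the structure map `P → A` of a finite algebra is
surjective modulo `t` near a prime `z` containing `t`, then it is surjective near `z`. -/
lemma exists_notMem_smul_mem_range_of_mod {P A : Type*} [CommRing P] [CommRing A] [Algebra P A]
    [Module.Finite P A] (t : P) (z : PrimeSpectrum P) (ht : t ∈ z.asIdeal)
    (h : ∀ e : A, ∃ s ∉ z.asIdeal, ∃ (p : P) (a : A), s • e = algebraMap P A p + t • a) (e : A) :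
    ∃ s ∉ z.asIdeal, ∃ p : P, s • e = algebraMap P A p := by
  let N : Submodule P A := LinearMap.range (Algebra.linearMap P A)
  have hz : z ∉ Module.support P (A ⧸ N) := by
    intro hz
    have hz' : z ∈ Module.support P ((A ⧸ N) ⧸ (Ideal.span {t} • ⊤ : Submodule P (A ⧸ N))) := by
      rw [Module.support_quotient]
      exact ⟨hz, by simpa [PrimeSpectrum.mem_zeroLocus] using ht⟩
    rw [Module.mem_support_iff'] at hz'
    obtain ⟨m, hm⟩ := hz'
    obtain ⟨m, rfl⟩ := Submodule.mkQ_surjective _ m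
    obtain ⟨m, rfl⟩ := Submodule.mkQ_surjective _ m
    obtain ⟨s, hs, p, a, hpa⟩ := h m
    refine hm s hs ?_
    rw [← map_smul, ← map_smul, hpa, map_add, map_add]
    have h1 : N.mkQ (algebraMap P A p) = 0 := by
      rw [Submodule.mkQ_apply, Submodule.Quotient.mk_eq_zero]
      exact ⟨p, rfl⟩
    rw [h1, map_zero, zero_add, map_smul, Submodule.mkQ_apply, Submodule.Quotient.mk_eq_zero]
    exact Submodule.smul_mem_smul (Ideal.mem_span_singleton_self t) trivial
  rw [Module.notMem_support_iff'] at hz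
  obtain ⟨s, hs, hs'⟩ := hz (N.mkQ e)
  rw [← map_smul, Submodule.mkQ_apply, Submodule.Quotient.mk_eq_zero] at hs'
  obtain ⟨p, hp⟩ := hs'
  exact ⟨s, hs, p, hp.symm⟩

/-- A Cohen–Macaulay local ring with an embedded or isolated component at its closed point has
dimension zero. -/
lemma IsCohenMacaulayLocalRing.ringKrullDim_eq_zero {L : Type u} [CommRing L] [IsLocalRing L]
    (h : IsCohenMacaulayLocalRing L) {c : L} (hc : c ≠ 0)
    (hm : ∀ r ∈ IsLocalRing.maximalIdeal L, ∃ k : ℕ, r ^ k * c = 0) : ringKrullDim L = 0 := by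
  obtain ⟨-, rs, hrs, hlen⟩ := h
  rw [← hlen]
  cases rs with
  | nil => simp
  | cons r rs =>
    exfalso
    have hr : r ∈ IsLocalRing.maximalIdeal L := by
      rw [IsLocalRing.mem_maximalIdeal]
      intro hu
      refine hrs.top_ne_smul ?_
      rw [Ideal.eq_top_of_isUnit_mem (Ideal.ofList (r :: rs))
        (Ideal.subset_span (by simp)) hu, Submodule.top_smul]
    obtain ⟨k, hk⟩ := hm r hr
    have h1 : IsSMulRegular L r := ((RingTheory.Sequence.isRegular_cons_iff _ _ _).1 hrs).1
    exact hc ((h1.pow k) (by simpa using hk))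

/-- At a prime minimal over the annihilator of a nonzero element, a localization which is
Cohen–Macaulay has dimension zero. -/
lemma ringKrullDim_eq_zero_of_mem_minimalPrimes {A : Type*} {L : Type u} [CommRing A]
    [CommRing L] [IsLocalRing L] [Algebra A L] (c : A) (I Q : Ideal A) [Q.IsPrime]
    (hI : ∀ s, s ∈ I ↔ s * c = 0) (hQ : Q ∈ I.minimalPrimes)
    [IsLocalization.AtPrime L Q] (h : IsCohenMacaulayLocalRing L) : ringKrullDim L = 0 := by
  refine h.ringKrullDim_eq_zero (c := algebraMap A L c) ?_ ?_
  · intro h0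
    obtain ⟨s, hs⟩ := (IsLocalization.map_eq_zero_iff Q.primeCompl L c).1 h0
    exact s.2 (hQ.1.2 ((hI _).2 hs))
  · intro r hr
    rw [← IsLocalization.AtPrime.map_eq_maximalIdeal Q L,
      ← IsLocalization.AtPrime.radical_map_of_mem_minimalPrimes L Q I hQ] at hr
    obtain ⟨k, hk⟩ := hr
    have hle : I.map (algebraMap A L) ≤ LinearMap.ker (LinearMap.toSpanSingleton L L
        (algebraMap A L c)) := by
      rw [Ideal.map_le_iff_le_comap]
      intro s hs
      simp only [Ideal.mem_comap, LinearMap.mem_ker, LinearMap.toSpanSingleton_apply, smul_eq_mul,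
        ← map_mul, (hI s).1 hs, map_zero]
    exact ⟨k, by simpa using hle hk⟩

/-- The base change of a flat algebra along an injection `R → K` contains the algebra. -/
lemma injective_of_isPushout_of_flat {R K A B : CommRingCat.{u}} {f : R ⟶ A} {g : R ⟶ K}
    {f' : A ⟶ B} {g' : K ⟶ B} (H : IsPushout f g f' g') (hf : f.hom.Flat)
    (hg : Function.Injective g.hom) : Function.Injective f'.hom := by
  algebraize [f.hom, g.hom, f'.hom, g'.hom, f'.hom.comp f.hom]
  have : IsScalarTower R K B := .of_algebraMap_eq' congr(($H.w).hom)
  have : Algebra.IsPushout R A K B := CommRingCat.isPushout_iff_isPushout.1 H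
  have h : Function.Injective (algebraMap A B) := by
    intro x y hxy
    apply Algebra.TensorProduct.includeLeft_injective (R := R) (S := R) (A := A) (B := K) hg
    apply (Algebra.IsPushout.equiv R A K B).injective
    simpa [Algebra.IsPushout.equiv_tmul] using hxy
  exact h

/-- The kernel of the base change of an algebra along a surjection `R → k`. -/
lemma ker_eq_map_of_isPushout {R K A B : CommRingCat.{u}} {f : R ⟶ A} {g : R ⟶ K}
    {f' : A ⟶ B} {g' : K ⟶ B} (H : IsPushout f g f' g')
    (hg : Function.Surjective g.hom) : RingHom.ker f'.hom = (RingHom.ker g.hom).map f.hom := by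
  have hw (r : R) : f' (f r) = g' (g r) := congr(($H.w).hom r)
  apply le_antisymm
  · let I := (RingHom.ker g.hom).map f.hom
    have hI : RingHom.ker g.hom ≤ RingHom.ker ((Ideal.Quotient.mk I).comp f.hom) := fun r hr ↦
      Ideal.Quotient.eq_zero_iff_mem.2 (Ideal.mem_map_of_mem _ hr)
    let l : K →+* A ⧸ I := g.hom.liftOfRightInverse _ (Function.rightInverse_surjInv hg)
      ⟨(Ideal.Quotient.mk I).comp f.hom, hI⟩
    have hl : f ≫ CommRingCat.ofHom (Ideal.Quotient.mk I) = g ≫ CommRingCat.ofHom l := by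
      ext r
      exact (RingHom.liftOfRightInverse_comp_apply g.hom _ (Function.rightInverse_surjInv hg)
        ⟨(Ideal.Quotient.mk I).comp f.hom, hI⟩ r).symm
    intro a ha
    have h0 : H.desc _ _ hl (f' a) = Ideal.Quotient.mk I a := congr(($(H.inl_desc _ _ hl)).hom a)
    rw [(show f' a = 0 from ha), map_zero] at h0
    exact Ideal.Quotient.eq_zero_iff_mem.1 h0.symm
  · rw [Ideal.map_le_iff_le_comap]
    intro r hr
    change f' (f r) = 0
    rw [hw, show g r = 0 from hr, map_zero]

/-- Elements of the base change of an algebra along a localization have denominators. -/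
lemma exists_mul_eq_of_isPushout {R K A B : CommRingCat.{u}} {f : R ⟶ A} {g : R ⟶ K}
    {f' : A ⟶ B} {g' : K ⟶ B} (H : IsPushout f g f' g') (M : Submonoid R)
    (hg : ∀ x, ∃ r ∈ M, ∃ y, g.hom r * x = g.hom y) (b : B) :
    ∃ r ∈ M, ∃ a, f' (f r) * b = f' a := by
  have hw (r : R) : g' (g r) = f' (f r) := congr(($H.w).hom r).symm
  have hb : b ∈ Subring.closure (Set.range f' ∪ Set.range g') := by
    rw [CommRingCat.closure_range_union_range_eq_top_of_isPushout H]; trivial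
  induction hb using Subring.closure_induction with
  | mem b hb =>
    obtain ⟨a, rfl⟩ | ⟨x, rfl⟩ := hb
    · exact ⟨1, M.one_mem, a, by simp⟩
    · obtain ⟨r, hr, y, hy⟩ := hg x
      refine ⟨r, hr, f y, ?_⟩
      rw [← hw, ← hw, ← map_mul]
      exact congr(g' $hy)
  | zero => exact ⟨1, M.one_mem, 0, by simp⟩
  | one => exact ⟨1, M.one_mem, 1, by simp⟩
  | neg x _ hx =>
    obtain ⟨r, hr, a, ha⟩ := hx
    exact ⟨r, hr, -a, by rw [mul_neg, ha, map_neg]⟩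
  | add x y _ _ hx hy =>
    obtain ⟨r, hr, a, ha⟩ := hx
    obtain ⟨s, hs, b, hb⟩ := hy
    refine ⟨r * s, M.mul_mem hr hs, f s * a + f r * b, ?_⟩
    simp only [map_mul, map_add, ← ha, ← hb]
    ring
  | mul x y _ _ hx hy =>
    obtain ⟨r, hr, a, ha⟩ := hx
    obtain ⟨s, hs, b, hb⟩ := hy
    refine ⟨r * s, M.mul_mem hr hs, a * b, ?_⟩
    simp only [map_mul, ← ha, ← hb]
    ring

lemma mem_basicOpen_iff_notMem_primeIdealOf {X : Scheme.{u}} {U : X.Opens} (hU : IsAffineOpen U)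
    (x : U) (s : Γ(X, U)) : x.1 ∈ X.basicOpen s ↔ s ∉ (hU.primeIdealOf x).asIdeal := by
  have := hU.isLocalization_stalk x
  rw [Scheme.mem_basicOpen']
  exact IsLocalization.AtPrime.isUnit_to_map_iff (X.presheaf.stalk x.1) _ s

/-- A point of a scheme whose local ring has dimension zero is generic. -/
lemma closure_singleton_mem_irreducibleComponents {X : Scheme.{u}} (y : X)
    (h : ringKrullDim (X.presheaf.stalk y) = 0) : closure {y} ∈ irreducibleComponents X := by
  refine ⟨isIrreducible_singleton.closure, fun Z hZ hyZ ↦ ?_⟩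
  have hη := hZ.isGenericPoint_genericPoint_closure
  have hsp : hZ.genericPoint ⤳ y := by
    rw [specializes_iff_mem_closure, hη.def]
    exact subset_closure (hyZ (subset_closure rfl))
  have : Ring.KrullDimLE 0 (X.presheaf.stalk y) := Ring.krullDimLE_iff.2 h.le
  have hsub : Subsingleton (Spec (X.presheaf.stalk y)) := by
    refine ⟨fun p q ↦ PrimeSpectrum.ext ?_⟩
    rw [IsLocalRing.eq_maximalIdeal (p.isPrime.isMaximal'),
      IsLocalRing.eq_maximalIdeal (q.isPrime.isMaximal')]
  have h1 : hZ.genericPoint ∈ Set.range (X.fromSpecStalk y) := by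
    rw [Scheme.range_fromSpecStalk]; exact hsp
  have h2 : y ∈ Set.range (X.fromSpecStalk y) := by
    rw [Scheme.range_fromSpecStalk]; exact specializes_rfl
  obtain ⟨p, hp⟩ := h1
  obtain ⟨q, hq⟩ := h2
  rw [← hq, Subsingleton.elim q p, hp, hη.def]
  exact subset_closure

lemma not_isClosed_singleton_of_ringKrullDim_eq_zero {X Y : Scheme.{u}} (f : X ⟶ Y) [IsFinite f]
    (hd : HasPureDimension X 1) (y : X) (h : ringKrullDim (X.presheaf.stalk y) = 0) :
    ¬ IsClosed {f y} := by
  intro hcl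
  have h1 := hd _ (closure_singleton_mem_irreducibleComponents y h)
  have hle : closure {y} ⊆ f ⁻¹' {f y} :=
    closure_minimal (by simp) (hcl.preimage f.continuous)
  have hdisc := ((f.isDiscrete_preimage_singleton (f y)).mono hle).to_subtype
  have h2 := topologicalKrullDim_zero_of_discreteTopology (closure {y})
  rw [h1] at h2
  exact absurd h2 (by simp)

/-- On a Cohen–Macaulay scheme of pure dimension one which is finite over `Y`, no nonzero local
section is supported on the preimage of the closed points of `Y`. -/
lemma exists_not_isClosed_of_ne_zero {X Y : Scheme.{u}} (f : X ⟶ Y) [IsFinite f]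
    (hX : IsCohenMacaulay X) (hd : HasPureDimension X 1) {V : X.Opens} (hV : IsAffineOpen V)
    {c : Γ(X, V)} (hc : c ≠ 0) :
    ∃ y ∈ V, ¬ IsClosed {f y} ∧ ∀ h : Γ(X, V), h * c = 0 → y ∉ X.basicOpen h := by
  let I : Ideal Γ(X, V) := LinearMap.ker (LinearMap.toSpanSingleton Γ(X, V) Γ(X, V) c)
  have hI (s) : s ∈ I ↔ s * c = 0 := by simp [I]
  have hI' : I ≠ ⊤ := fun h ↦ hc (by simpa using (hI 1).1 (h ▸ trivial))
  obtain ⟨Q, hQ⟩ := Ideal.nonempty_minimalPrimes hI'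
  have hQp : Q.IsPrime := hQ.1.1
  obtain ⟨y, hy⟩ : ∃ y : V, hV.primeIdealOf y = ⟨Q, hQp⟩ :=
    ⟨hV.isoSpec.inv ⟨Q, hQp⟩, Scheme.inv_hom_apply hV.isoSpec _⟩
  refine ⟨y.1, y.2, ?_, fun h hh ↦ ?_⟩
  · apply not_isClosed_singleton_of_ringKrullDim_eq_zero f hd
    have := hV.isLocalization_stalk y
    rw [hy] at this
    exact ringKrullDim_eq_zero_of_mem_minimalPrimes c I Q hI hQ (hX y.1)
  · rw [mem_basicOpen_iff_notMem_primeIdealOf hV, hy, not_not]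
    exact hQ.1.2 ((hI h).2 hh)

lemma app_surjective_of_isIso_morphismRestrict {X Y : Scheme.{u}} (g : X ⟶ Y) {W D : Y.Opens}
    (hD : D ≤ W) [IsIso (g ∣_ W)] : Function.Surjective (g.app D) := by
  obtain ⟨D, rfl⟩ : ∃ D' : W.toScheme.Opens, D = W.ι ''ᵁ D' := ⟨W.ι ⁻¹ᵁ D, by
    rw [Scheme.Hom.image_preimage_eq_opensRange_inf, Scheme.Opens.opensRange_ι, inf_eq_right.2 hD]⟩
  have h : IsIso ((g ∣_ W).app D) := inferInstance
  rw [morphismRestrict_app', Scheme.Hom.appLE] at h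
  have h2 : IsIso (g.app (W.ι ''ᵁ D)) := by
    refine @IsIso.of_isIso_comp_right _ _ _ _ _ _ _ ?_ h
    have := image_morphismRestrict_preimage g W D
    exact Functor.map_isIso X.presheaf (eqToHom this).op
  exact (ConcreteCategory.bijective_of_isIso (g.app (W.ι ''ᵁ D))).2

lemma app_comp_surjective {X Y Z : Scheme.{u}} {f : X ⟶ Y} {g : X ⟶ Z} {i : Z ⟶ Y}
    (hf : f = g ≫ i) {D : Y.Opens} (hi : Function.Surjective (i.app D))
    (hg : Function.Surjective (g.app (i ⁻¹ᵁ D))) : Function.Surjective (f.app D) := by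
  subst hf
  rw [Scheme.Hom.comp_app]
  exact hg.comp hi

/-- If `f : X ⟶ Y` is an isomorphism onto its image away from closed points, then `𝒪_Y ⟶ f_* 𝒪_X`
is surjective away from closed points. -/
lemma IsIsoOntoImageAwayFromFinite.exists_mul_eq {X Y : Scheme.{u}} {f : X ⟶ Y}
    (hf : IsIsoOntoImageAwayFromFinite f) {U : Y.Opens} (hU : IsAffineOpen U)
    {V : X.Opens} (hV : V = f ⁻¹ᵁ U) (hVa : IsAffineOpen V) {z : Y} (hz : z ∈ U)
    (hzc : ¬ IsClosed {z}) (e : Γ(X, V)) :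
    ∃ s : Γ(Y, U), z ∈ Y.basicOpen s ∧ ∃ p : Γ(Y, U),
      f.appLE U V hV.le s * e = f.appLE U V hV.le p := by
  obtain ⟨W, -, hW, hiso⟩ := hf
  have hzW : z ∉ f.imageι '' (W : Set f.image)ᶜ := by
    rintro ⟨x, hx, rfl⟩
    refine hzc ?_
    rw [← Set.image_singleton]
    exact f.imageι.isClosedEmbedding.isClosedMap _ (hW x hx)
  have hcl : IsClosed (f.imageι '' (W : Set f.image)ᶜ) :=
    f.imageι.isClosedEmbedding.isClosedMap _ W.isOpen.isClosed_compl
  obtain ⟨s, hs, hzs⟩ := hU.exists_basicOpen_le (V := ⟨_, hcl.isOpen_compl⟩) ⟨z, hzW⟩ hz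
  have hsW : f.imageι ⁻¹ᵁ Y.basicOpen s ≤ W := by
    intro x hx
    by_contra hxW
    exact hs hx ⟨x, hxW, rfl⟩
  have hsurj : Function.Surjective (f.app (Y.basicOpen s)) :=
    app_comp_surjective f.toImage_imageι.symm
      (f.imageι.app_surjective _ (hU.basicOpen s)) (app_surjective_of_isIso_morphismRestrict _ hsW)
  subst hV
  have h1 := hU.isLocalization_basicOpen s
  have h2 := hVa.isLocalization_basicOpen (f.app U s)
  have hle : X.basicOpen (f.app U s) ≤ f ⁻¹ᵁ U := X.basicOpen_le _
  have heq : f ⁻¹ᵁ Y.basicOpen s = X.basicOpen (f.app U s) := by simp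
  obtain ⟨q, hq⟩ : ∃ q, f.appLE (Y.basicOpen s) (X.basicOpen (f.app U s)) heq.ge q =
      X.presheaf.map (homOfLE hle).op e := by
    obtain ⟨q, hq⟩ := hsurj (X.presheaf.map (homOfLE (heq.le.trans hle)).op e)
    refine ⟨q, ?_⟩
    rw [Scheme.Hom.appLE, CommRingCat.comp_apply]
    erw [hq]
    rw [← CommRingCat.comp_apply, ← Functor.map_comp]
    rfl
  obtain ⟨k, p, hp⟩ := IsLocalization.Away.surj s q
  have hr (p) : X.presheaf.map (homOfLE hle).op (f.app U p) =
      f.appLE (Y.basicOpen s) (X.basicOpen (f.app U s)) heq.ge (algebraMap _ _ p) := by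
    have h3 := f.map_appLE (U' := U) (U := Y.basicOpen s) heq.ge (homOfLE (Y.basicOpen_le s)).op
    exact congr(($h3.symm).hom p)
  have hp' : X.presheaf.map (homOfLE hle).op (f.app U s ^ k * e) =
      X.presheaf.map (homOfLE hle).op (f.app U p) := by
    rw [map_mul, map_pow, hr, hr, ← hq, ← hp, map_mul, map_pow, mul_comm]
  obtain ⟨m, hm⟩ := IsLocalization.Away.exists_of_eq (S := Γ(X, X.basicOpen (f.app U s)))
    (f.app U s) hp'
  refine ⟨s ^ (m + k), ?_, s ^ m * p, ?_⟩
  · rw [Scheme.mem_basicOpen _ _ z hz, map_pow]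
    exact ((Scheme.mem_basicOpen _ _ z hz).1 hzs).pow _
  · simp only [Scheme.Hom.appLE_eq_app, map_mul, map_pow, ← hm]
    ring

section BaseChange

variable {S T X X' : Scheme.{u}} {g : T ⟶ S} {π : X ⟶ S} {l : X' ⟶ X} {π' : X' ⟶ T}

lemma isPushout_app_of_isPullback (H : IsPullback l π' π g) [IsAffine S] [IsAffine T]
    {V : X.Opens} (hV : IsAffineOpen V) :
    IsPushout (π.appLE ⊤ V le_top) g.appTop (l.app V) (π'.appLE ⊤ (l ⁻¹ᵁ V) le_top) := by
  have h := (isIso_pushoutSection_iff H (US := ⊤) (UT := ⊤) (UX := V) (UY := l ⁻¹ᵁ V)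
    le_top le_top (by simp)).1
    (isIso_pushoutSection_of_isAffineOpen H _ _ _ (isAffineOpen_top S) (isAffineOpen_top T) hV)
  rw [Scheme.Hom.app_eq_appLE, Scheme.Hom.appTop, Scheme.Hom.app_eq_appLE]
  exact h

lemma ker_app_of_isPullback (H : IsPullback l π' π g) [IsAffine S] [IsAffine T]
    (hg : Function.Surjective g.appTop) {ϖ : Γ(S, ⊤)}
    (hϖ : RingHom.ker g.appTop.hom = Ideal.span {ϖ}) {V : X.Opens} (hV : IsAffineOpen V) :
    RingHom.ker (l.app V).hom = Ideal.span {π.appLE ⊤ V le_top ϖ} := by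
  rw [ker_eq_map_of_isPushout (isPushout_app_of_isPullback H hV) hg, hϖ, Ideal.map_span,
    Set.image_singleton]

lemma app_injective_of_isPullback (H : IsPullback l π' π g) [IsAffine S] [IsAffine T] [Flat π]
    (hg : Function.Injective g.appTop) {V : X.Opens} (hV : IsAffineOpen V) :
    Function.Injective (l.app V) :=
  injective_of_isPushout_of_flat (isPushout_app_of_isPullback H hV)
    (π.flat_appLE (isAffineOpen_top S) hV _) hg

lemma exists_pow_mul_eq_app_of_isPullback (H : IsPullback l π' π g) [IsAffine S] [IsAffine T]
    {ϖ : Γ(S, ⊤)} (hg : ∀ x, ∃ (n : ℕ) (y : Γ(S, ⊤)), g.appTop ϖ ^ n * x = g.appTop y)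
    {V : X.Opens} (hV : IsAffineOpen V) (b : Γ(X', l ⁻¹ᵁ V)) :
    ∃ (n : ℕ) (a : Γ(X, V)), l.app V (π.appLE ⊤ V le_top ϖ) ^ n * b = l.app V a := by
  obtain ⟨r, ⟨n, rfl⟩, a, ha⟩ := exists_mul_eq_of_isPushout (isPushout_app_of_isPullback H hV)
    (Submonoid.powers ϖ) (fun x ↦ by
      obtain ⟨n, y, h⟩ := hg x
      exact ⟨_, ⟨n, rfl⟩, y, by simpa using h⟩) b
  exact ⟨n, a, by simpa using ha⟩

end BaseChange

section SpecialFiber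

variable {S S₀ Y Y₀ C C₀ : Scheme.{u}} [IsAffine S] [IsAffine S₀] {g : S₀ ⟶ S}
  {ϖ : Γ(S, ⊤)} {ρ : Y ⟶ S} {ρ₀ : Y₀ ⟶ S₀} {j : Y₀ ⟶ Y} {i : C ⟶ Y} {i₀ : C₀ ⟶ Y₀} {l : C₀ ⟶ C}

/-- If the special fiber of `C` is isomorphic to its image away from closed points, then
`𝒪_Y ⟶ i_* 𝒪_C` is surjective away from closed points of the special fiber. -/
lemma exists_mul_eq_of_specialFiber [IsClosedImmersion j] [IsFinite i] [IsAffineHom i₀]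
    (hg : Function.Surjective g.appTop) (hϖ : RingHom.ker g.appTop.hom = Ideal.span {ϖ})
    (hj : j ≫ ρ = ρ₀ ≫ g) (hl : l ≫ i = i₀ ≫ j)
    (H : IsPullback l (i₀ ≫ ρ₀) (i ≫ ρ) g) (hiso : IsIsoOntoImageAwayFromFinite i₀)
    {U : Y.Opens} (hU : IsAffineOpen U) {z : Y₀} (hz : j z ∈ U) (hzc : ¬ IsClosed {z})
    (e : Γ(C, i ⁻¹ᵁ U)) :
    ∃ s : Γ(Y, U), j z ∈ Y.basicOpen s ∧ ∃ p : Γ(Y, U), i.app U s * e = i.app U p := by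
  algebraize [(i.app U).hom]
  have hfin : Module.Finite Γ(Y, U) Γ(C, i ⁻¹ᵁ U) := i.finite_app U hU
  let t : Γ(Y, U) := ρ.appLE ⊤ U le_top ϖ
  have ht : t ∈ (hU.primeIdealOf ⟨j z, hz⟩).asIdeal := by
    rw [← not_not (a := t ∈ _), ← mem_basicOpen_iff_notMem_primeIdealOf]
    intro hzt
    have hg0 : g.appTop ϖ = 0 := by
      have : ϖ ∈ RingHom.ker g.appTop.hom := hϖ ▸ Ideal.mem_span_singleton_self ϖ
      exact this
    have h1 : ρ (j z) ∈ S.basicOpen ϖ :=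
      ((Scheme.basicOpen_appLE ρ U ⊤ le_top ϖ).le.trans inf_le_right) hzt
    rw [← Scheme.Hom.comp_apply, hj, Scheme.Hom.comp_apply] at h1
    have h3 : ρ₀ z ∈ g ⁻¹ᵁ S.basicOpen ϖ := h1
    rw [Scheme.preimage_basicOpen_top, hg0, Scheme.basicOpen_zero] at h3
    exact h3
  have hV₀ : l ⁻¹ᵁ i ⁻¹ᵁ U = i₀ ⁻¹ᵁ j ⁻¹ᵁ U := by
    rw [← Scheme.Hom.comp_preimage, hl, Scheme.Hom.comp_preimage]
  have hV : IsAffineOpen (i ⁻¹ᵁ U) := hU.preimage i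
  have hcomm (p : Γ(Y, U)) :
      l.app (i ⁻¹ᵁ U) (i.app U p) = i₀.appLE (j ⁻¹ᵁ U) _ hV₀.le (j.app U p) := by
    have h : i.app U ≫ l.app (i ⁻¹ᵁ U) = j.app U ≫ i₀.appLE (j ⁻¹ᵁ U) _ hV₀.le := by
      rw [Scheme.Hom.app_eq_appLE, Scheme.Hom.app_eq_appLE, Scheme.Hom.app_eq_appLE,
        Scheme.Hom.appLE_comp_appLE, Scheme.Hom.appLE_comp_appLE]
      congr 1
    exact congr(($h).hom p)
  have key (e : Γ(C, i ⁻¹ᵁ U)) : ∃ s ∉ (hU.primeIdealOf ⟨j z, hz⟩).asIdeal,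
      ∃ (p : Γ(Y, U)) (a : Γ(C, i ⁻¹ᵁ U)), s • e = algebraMap _ _ p + t • a := by
    obtain ⟨s₀, hs₀, p₀, h₀⟩ := hiso.exists_mul_eq (hU.preimage j) hV₀
      (hV₀ ▸ (hU.preimage j).preimage i₀) hz hzc (l.app _ e)
    obtain ⟨s, rfl⟩ := j.app_surjective U hU s₀
    obtain ⟨p, rfl⟩ := j.app_surjective U hU p₀
    have hker : i.app U s * e - i.app U p ∈ RingHom.ker (l.app (i ⁻¹ᵁ U)).hom := by
      rw [RingHom.mem_ker, map_sub, map_mul, sub_eq_zero]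
      erw [hcomm, hcomm]
      exact h₀
    rw [ker_app_of_isPullback H hg hϖ hV, Ideal.mem_span_singleton] at hker
    obtain ⟨a, ha⟩ := hker
    refine ⟨s, ?_, p, a, ?_⟩
    · rw [← mem_basicOpen_iff_notMem_primeIdealOf]
      rw [← Scheme.preimage_basicOpen] at hs₀
      exact hs₀
    · rw [Algebra.smul_def, Algebra.smul_def, ← sub_eq_iff_eq_add']
      refine ha.trans ?_
      have h : ρ.appLE ⊤ U le_top ≫ i.app U = (i ≫ ρ).appLE ⊤ (i ⁻¹ᵁ U) le_top := by
        rw [Scheme.Hom.app_eq_appLE]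
        exact Scheme.Hom.appLE_comp_appLE i ρ _ _ _ _ _
      exact congr(($h.symm).hom ϖ * a)
  obtain ⟨s, hs, p, hp⟩ := exists_notMem_smul_mem_range_of_mod t _ ht key e
  exact ⟨s, (mem_basicOpen_iff_notMem_primeIdealOf hU ⟨j z, hz⟩ s).2 hs, p, hp⟩

/-- A section of the generic fiber which extends away from closed points of the special fiber
extends, if the special fiber is Cohen–Macaulay of pure dimension one. -/
lemma mem_range_app_of_specialFiber [IsFinite i₀] [IsAffineHom i]
    (hg : Function.Surjective g.appTop) (hϖ : RingHom.ker g.appTop.hom = Ideal.span {ϖ})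
    (hl : l ≫ i = i₀ ≫ j) (H : IsPullback l (i₀ ≫ ρ₀) (i ≫ ρ) g)
    (hCM : IsCohenMacaulay C₀) (hd : HasPureDimension C₀ 1)
    {U : Y.Opens} (hU : IsAffineOpen U) {B : Type u} [CommRing B] (φ : Γ(C, i ⁻¹ᵁ U) →+* B)
    (hφ : Function.Injective φ) (hunit : IsUnit (φ ((i ≫ ρ).appLE ⊤ (i ⁻¹ᵁ U) le_top ϖ)))
    (b : B) (hb : ∀ z, j z ∈ U → ¬ IsClosed {z} →
      ∃ s : Γ(Y, U), j z ∈ Y.basicOpen s ∧ ∃ a, φ (i.app U s) * b = φ a)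
    (n : ℕ) (hn : ∃ a, φ ((i ≫ ρ).appLE ⊤ (i ⁻¹ᵁ U) le_top ϖ) ^ n * b = φ a) :
    b ∈ φ.range := by
  have hV : IsAffineOpen (i ⁻¹ᵁ U) := hU.preimage i
  have hker := ker_app_of_isPullback H hg hϖ hV
  set t := (i ≫ ρ).appLE ⊤ (i ⁻¹ᵁ U) le_top ϖ
  induction n generalizing b with
  | zero =>
    obtain ⟨a, ha⟩ := hn
    exact ⟨a, by simpa using ha.symm⟩
  | succ n ih =>
    obtain ⟨c, hc⟩ := ih (φ t * b) (fun z hz hzc ↦ by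
      obtain ⟨s, hs, a, ha⟩ := hb z hz hzc
      exact ⟨s, hs, t * a, by rw [mul_left_comm, ha, map_mul]⟩) (by
      obtain ⟨a, ha⟩ := hn
      exact ⟨a, by rw [← ha]; ring⟩)
    by_cases hc0 : l.app (i ⁻¹ᵁ U) c = 0
    · have hmem : c ∈ RingHom.ker (l.app (i ⁻¹ᵁ U)).hom := hc0
      rw [hker, Ideal.mem_span_singleton] at hmem
      obtain ⟨a, rfl⟩ := hmem
      rw [map_mul] at hc
      exact ⟨a, hunit.mul_left_cancel hc⟩
    · exfalso
      have hV₀ : IsAffineOpen (l ⁻¹ᵁ i ⁻¹ᵁ U) := by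
        have : IsAffineHom l := MorphismProperty.of_isPullback H.flip inferInstance
        exact hV.preimage l
      obtain ⟨y, hy, hyc, hyb⟩ := exists_not_isClosed_of_ne_zero i₀ hCM hd hV₀ hc0
      have hy' : j (i₀ y) = i (l y) := by
        rw [← Scheme.Hom.comp_apply, ← Scheme.Hom.comp_apply, hl]
      obtain ⟨s, hs, a, ha⟩ := hb (i₀ y) (by rw [hy']; exact hy) hyc
      have h1 : i.app U s * c = t * a := by
        apply hφ
        rw [map_mul, hc, mul_left_comm, ha, map_mul]
      have ht : l.app (i ⁻¹ᵁ U) t = 0 := by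
        have : t ∈ RingHom.ker (l.app (i ⁻¹ᵁ U)).hom := by
          rw [hker]; exact Ideal.mem_span_singleton_self t
        exact this
      refine hyb (l.app _ (i.app U s)) ?_ ?_
      · rw [← map_mul, h1, map_mul, ht, zero_mul]
      · rw [← Scheme.preimage_basicOpen, ← Scheme.preimage_basicOpen]
        change i (l y) ∈ Y.basicOpen s
        rwa [← hy']

end SpecialFiber

section Graph

variable {Y C C' D E : Scheme.{u}} {i : C ⟶ Y} {i' : C' ⟶ Y} {q : D ⟶ C} {q' : D ⟶ C'}

lemma preimage_preimage_eq (w : q ≫ i = q' ≫ i') (U : Y.Opens) :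
    q ⁻¹ᵁ i ⁻¹ᵁ U = q' ⁻¹ᵁ i' ⁻¹ᵁ U := by
  rw [← Scheme.Hom.comp_preimage, w, Scheme.Hom.comp_preimage]

lemma closure_range_union_range_eq_top [IsAffineHom i] [IsAffineHom i'] (w : q ≫ i = q' ≫ i')
    [IsClosedImmersion (pullback.lift q q' w)] {U : Y.Opens} (hU : IsAffineOpen U) :
    Subring.closure (Set.range (q.app (i ⁻¹ᵁ U)) ∪
      Set.range (q'.appLE (i' ⁻¹ᵁ U) (q ⁻¹ᵁ i ⁻¹ᵁ U) (preimage_preimage_eq w U).le)) = ⊤ := by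
  let V : (pullback i i').Opens := pullback.fst i i' ⁻¹ᵁ i ⁻¹ᵁ U
  have hV : V = pullback.snd i i' ⁻¹ᵁ i' ⁻¹ᵁ U := preimage_preimage_eq pullback.condition U
  have h := (isIso_pushoutSection_iff (IsPullback.of_hasPullback i i') (US := U)
    (UT := i' ⁻¹ᵁ U) (UX := i ⁻¹ᵁ U) (UY := V) le_rfl le_rfl (by rw [← hV, inf_idem])).1
    (isIso_pushoutSection_of_isAffineOpen _ _ _ _ hU (hU.preimage i') (hU.preimage i))
  have hfst : IsAffineHom (pullback.fst i i') :=
      MorphismProperty.of_isPullback (IsPullback.of_hasPullback i i').flip ‹IsAffineHom i'›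
  have hcl := CommRingCat.closure_range_union_range_eq_top_of_isPushout h
  have hsurj := (pullback.lift q q' w).app_surjective V ((hU.preimage i).preimage _)
  have hqV : q ⁻¹ᵁ i ⁻¹ᵁ U = pullback.lift q q' w ⁻¹ᵁ V := by
    rw [← Scheme.Hom.comp_preimage (pullback.lift q q' w), pullback.lift_fst]
  let r := (pullback.lift q q' w).appLE V (q ⁻¹ᵁ i ⁻¹ᵁ U) hqV.le
  have hr : Function.Surjective r := by
    have : IsIso (D.presheaf.map (homOfLE hqV.le).op) :=
      Functor.map_isIso D.presheaf (eqToHom hqV).op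
    exact (ConcreteCategory.bijective_of_isIso (D.presheaf.map (homOfLE hqV.le).op)).2.comp hsurj
  have h1 : (pullback.fst i i').appLE (i ⁻¹ᵁ U) V le_rfl ≫ r = q.app (i ⁻¹ᵁ U) := by
    rw [Scheme.Hom.appLE_comp_appLE, Scheme.Hom.app_eq_appLE]
    congr 1
    exact pullback.lift_fst _ _ _
  have h2 : (pullback.snd i i').appLE (i' ⁻¹ᵁ U) V hV.le ≫ r =
      q'.appLE (i' ⁻¹ᵁ U) (q ⁻¹ᵁ i ⁻¹ᵁ U) (preimage_preimage_eq w U).le := by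
    rw [Scheme.Hom.appLE_comp_appLE]
    congr 1
    exact pullback.lift_snd _ _ _
  have hunion : Set.range (q.app (i ⁻¹ᵁ U)) ∪
      Set.range (q'.appLE (i' ⁻¹ᵁ U) (q ⁻¹ᵁ i ⁻¹ᵁ U) (preimage_preimage_eq w U).le) =
      r.hom '' (Set.range ((pullback.fst i i').appLE (i ⁻¹ᵁ U) V le_rfl) ∪
        Set.range ((pullback.snd i i').appLE (i' ⁻¹ᵁ U) V hV.le)) := by
    rw [Set.image_union, ← Set.range_comp, ← Set.range_comp, ← h1, ← h2]
    rfl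
  rw [hunion, ← RingHom.map_closure]
  refine (congrArg (Subring.map r.hom) hcl).trans ?_
  rw [← RingHom.range_eq_map]
  exact RingHom.range_eq_top.2 hr

lemma isIso_of_range_le [IsAffineHom i] [IsAffineHom i'] (w : q ≫ i = q' ≫ i')
    [IsClosedImmersion (pullback.lift q q' w)] {l : E ⟶ C} (e : E ⟶ D) (he : e ≫ q = l)
    (hinj : ∀ U : Y.Opens, IsAffineOpen U → Function.Injective (e.app (q ⁻¹ᵁ i ⁻¹ᵁ U)))
    (hl : ∀ U : Y.Opens, IsAffineOpen U → Function.Injective (l.app (i ⁻¹ᵁ U)))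
    (h : ∀ (U : Y.Opens) (_ : IsAffineOpen U) (hle) (a : Γ(C', i' ⁻¹ᵁ U)),
      (e ≫ q').appLE (i' ⁻¹ᵁ U) (l ⁻¹ᵁ i ⁻¹ᵁ U) hle a ∈ (l.app (i ⁻¹ᵁ U)).hom.range) :
    IsIso q := by
  subst he
  have : IsAffineHom q := by
    have hfst : IsAffineHom (pullback.fst i i') :=
      MorphismProperty.of_isPullback (IsPullback.of_hasPullback i i').flip ‹IsAffineHom i'›
    rw [← pullback.lift_fst q q' w]
    infer_instance
  have hiso (U : Y.Opens) (hU : IsAffineOpen U) : IsIso (q ∣_ i ⁻¹ᵁ U) := by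
    rw [isIso_morphismRestrict_iff_isIso_app _ (hU.preimage i)]
    have hcomp : (e ≫ q).app (i ⁻¹ᵁ U) = q.app (i ⁻¹ᵁ U) ≫ e.app (q ⁻¹ᵁ i ⁻¹ᵁ U) :=
      Scheme.Hom.comp_app _ _ _
    refine (ConcreteCategory.isIso_iff_bijective _).2 ⟨?_, ?_⟩
    · have := hl U hU
      rw [hcomp] at this
      exact Function.Injective.of_comp this
    · intro x
      have hx : x ∈ (⊤ : Subring _) := trivial
      rw [← closure_range_union_range_eq_top w hU] at hx
      have hle : Subring.closure (Set.range (q.app (i ⁻¹ᵁ U)) ∪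
          Set.range (q'.appLE (i' ⁻¹ᵁ U) (q ⁻¹ᵁ i ⁻¹ᵁ U) (preimage_preimage_eq w U).le)) ≤
          (q.app (i ⁻¹ᵁ U)).hom.range := by
        rw [Subring.closure_le]
        rintro _ (⟨a, rfl⟩ | ⟨a, rfl⟩)
        · exact ⟨a, rfl⟩
        · have hle : (e ≫ q) ⁻¹ᵁ i ⁻¹ᵁ U ≤ (e ≫ q') ⁻¹ᵁ i' ⁻¹ᵁ U :=
            (preimage_preimage_eq (by rw [Category.assoc, w, Category.assoc]) U).le
          obtain ⟨c, hc⟩ := h U hU hle a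
          refine ⟨c, hinj U hU ?_⟩
          rw [hcomp] at hc
          refine hc.trans ?_
          have := Scheme.Hom.appLE_comp_appLE e q' (i' ⁻¹ᵁ U) (q ⁻¹ᵁ i ⁻¹ᵁ U)
            (e ⁻¹ᵁ q ⁻¹ᵁ i ⁻¹ᵁ U) (preimage_preimage_eq w U).le le_rfl
          rw [← Scheme.Hom.app_eq_appLE] at this
          exact congr(($this.symm).hom a)
      exact hle hx
  refine (IsZariskiLocalAtTarget.iff_of_iSup_eq_top (P := .isomorphisms Scheme)
    (fun U : Y.affineOpens ↦ i ⁻¹ᵁ U.1) ?_).2 (fun U ↦ hiso U.1 U.2)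
  exact i.iSup_preimage_eq_top (iSup_affineOpens_eq_top Y)

end Graph

section DVR

/-- The closed point of the spectrum of a local ring. -/
def specClosedPoint (R : Type u) [CommRing R] [IsLocalRing R] : Spec (CommRingCat.of R) :=
  IsLocalRing.closedPoint R

instance (R : Type u) [CommRing R] [IsLocalRing R] : IsClosedImmersion
    ((Spec (CommRingCat.of R)).fromSpecResidueField (specClosedPoint R)) :=
  isClosed_singleton_iff_isClosedImmersion.1 (IsLocalRing.isClosed_singleton_closedPoint R)

/-- A global function on the spectrum of a ring. -/
def specFunction {R : Type u} [CommRing R] (r : R) : Γ(Spec (CommRingCat.of R), ⊤) :=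
  (Scheme.ΓSpecIso (CommRingCat.of R)).inv r

lemma specFunction_surjective {R : Type u} [CommRing R] :
    Function.Surjective (specFunction (R := R)) :=
  (ConcreteCategory.bijective_of_isIso (Scheme.ΓSpecIso (CommRingCat.of R)).inv).2

lemma ker_appTop_fromSpecResidueField {R : Type u} [CommRing R] [IsDomain R]
    [IsDiscreteValuationRing R] {π : R} (hπ : Irreducible π) :
    RingHom.ker ((Spec (CommRingCat.of R)).fromSpecResidueField
      (specClosedPoint R)).appTop.hom = Ideal.span {specFunction π} := by
  set g := (Spec (CommRingCat.of R)).fromSpecResidueField (specClosedPoint R)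
  let k := (Spec (CommRingCat.of R)).residueField (specClosedPoint R)
  let r : R →+* k :=
    ((Scheme.ΓSpecIso (CommRingCat.of R)).inv ≫ g.appTop ≫ (Scheme.ΓSpecIso k).hom).hom
  have hr (x : R) : r x = (Scheme.ΓSpecIso k).hom (g.appTop (specFunction x)) := rfl
  have hs : Function.Surjective r :=
    ((ConcreteCategory.bijective_of_isIso (Scheme.ΓSpecIso k).hom).2.comp
      (g.app_surjective ⊤ (isAffineOpen_top _))).comp specFunction_surjective
  have hker : RingHom.ker r = Ideal.span {π} := by
    rw [← hπ.maximalIdeal_eq]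
    exact IsLocalRing.eq_maximalIdeal (RingHom.ker_isMaximal_of_surjective r hs)
  have hr0 (x : R) : specFunction x ∈ RingHom.ker g.appTop.hom ↔ x ∈ RingHom.ker r := by
    rw [RingHom.mem_ker, RingHom.mem_ker, hr]
    exact (map_eq_zero_iff _
      (ConcreteCategory.bijective_of_isIso (Scheme.ΓSpecIso k).hom).1).symm
  ext x
  obtain ⟨x, rfl⟩ := specFunction_surjective x
  rw [hr0, hker, Ideal.mem_span_singleton, Ideal.mem_span_singleton]
  exact (map_dvd_iff (Scheme.ΓSpecIso (CommRingCat.of R)).symm.commRingCatIsoToRingEquiv).symm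

variable (R K : Type u) [CommRing R] [Field K] [Algebra R K]

lemma appTop_specFunction (r : R) :
    (Spec.map (CommRingCat.ofHom (algebraMap R K))).appTop (specFunction r) =
      specFunction (algebraMap R K r) :=
  congr(($(Scheme.ΓSpecIso_inv_naturality (CommRingCat.ofHom (algebraMap R K))).hom r)).symm

lemma appTop_injective [IsFractionRing R K] :
    Function.Injective (Spec.map (CommRingCat.ofHom (algebraMap R K))).appTop := by
  intro x y hxy
  obtain ⟨x, rfl⟩ := specFunction_surjective x
  obtain ⟨y, rfl⟩ := specFunction_surjective y
  rw [appTop_specFunction, appTop_specFunction] at hxy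
  have h := (ConcreteCategory.bijective_of_isIso (Scheme.ΓSpecIso (CommRingCat.of K)).inv).1 hxy
  rw [IsFractionRing.injective R K h]

lemma isUnit_appTop [IsFractionRing R K] {r : R} (hr : r ≠ 0) :
    IsUnit ((Spec.map (CommRingCat.ofHom (algebraMap R K))).appTop (specFunction r)) := by
  rw [appTop_specFunction]
  have h : IsUnit (algebraMap R K r) :=
    (by simpa using hr : algebraMap R K r ≠ 0).isUnit
  exact h.map (Scheme.ΓSpecIso (CommRingCat.of K)).inv.hom

lemma exists_pow_mul_eq_appTop [IsDomain R] [IsDiscreteValuationRing R] [IsFractionRing R K]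
    {π : R} (hπ : Irreducible π)
    (x : Γ(Spec (CommRingCat.of K), ⊤)) :
    ∃ (n : ℕ) (y : Γ(Spec (CommRingCat.of R), ⊤)),
      (Spec.map (CommRingCat.ofHom (algebraMap R K))).appTop (specFunction π) ^ n * x =
        (Spec.map (CommRingCat.ofHom (algebraMap R K))).appTop y := by
  obtain ⟨x, rfl⟩ := specFunction_surjective x
  obtain ⟨a, b, hb, rfl⟩ := IsFractionRing.div_surjective (A := R) x
  obtain ⟨n, v, hv⟩ := IsDiscreteValuationRing.eq_unit_mul_pow_irreducible
    (nonZeroDivisors.ne_zero hb) hπ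
  refine ⟨n, specFunction (↑v⁻¹ * a), ?_⟩
  rw [appTop_specFunction, appTop_specFunction]
  change (Scheme.ΓSpecIso (CommRingCat.of K)).inv _ ^ n *
    (Scheme.ΓSpecIso (CommRingCat.of K)).inv _ = (Scheme.ΓSpecIso (CommRingCat.of K)).inv _
  rw [← map_pow, ← map_mul]
  congr 1
  have hb0 : algebraMap R K b ≠ 0 := by simpa using nonZeroDivisors.ne_zero hb
  rw [mul_div_assoc', div_eq_iff hb0, ← map_pow, ← map_mul, ← map_mul, hv]
  congr 1
  rw [mul_mul_mul_comm, mul_comm a, ← mul_assoc, Units.inv_mul, one_mul]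

end DVR

section Fiber

variable {n : ℕ} {S T : Scheme.{u}} (g : T ⟶ S) (P : Pair n S)

/-- The morphism `ℙⁿ_T ⟶ ℙⁿ_S`. -/
def projSpaceMap : projSpace.{u} n T ⟶ projSpace.{u} n S :=
  pullback.lift (pullback.fst _ _ ≫ g) (pullback.snd _ _) (terminal.hom_ext _ _)

lemma isPullback_projSpaceMap :
    IsPullback (projSpaceMap (n := n) g) (pullback.fst _ _) (pullback.fst _ _) g := by
  refine (IsPullback.of_right (h₁₂ := pullback.snd _ _) (v₁₃ := terminal.from _)
    (h₂₂ := terminal.from _) ?_ ?_ (IsPullback.of_hasPullback _ _).flip)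
  · rw [projSpaceMap, pullback.lift_snd, Subsingleton.elim (g ≫ terminal.from S) (terminal.from T)]
    exact (IsPullback.of_hasPullback _ _).flip
  · rw [projSpaceMap, pullback.lift_fst]

instance [IsClosedImmersion g] : IsClosedImmersion (projSpaceMap (n := n) g) :=
  MorphismProperty.of_isPullback (isPullback_projSpaceMap g).flip ‹_›

lemma baseChange_hom_comp_fst : (P.baseChange g).hom ≫ pullback.fst _ _ = pullback.snd _ _ :=
  pullback.lift_fst _ _ _

lemma baseChange_hom_comp_snd :
    (P.baseChange g).hom ≫ pullback.snd _ _ = pullback.fst P.toBase g ≫ P.toProjInt :=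
  pullback.lift_snd _ _ _

lemma fst_comp_hom_eq :
    pullback.fst P.toBase g ≫ P.hom = (P.baseChange g).hom ≫ projSpaceMap g := by
  apply pullback.hom_ext
  · rw [projSpaceMap, Category.assoc, Category.assoc, pullback.lift_fst,
      reassoc_of% baseChange_hom_comp_fst]
    exact pullback.condition
  · rw [projSpaceMap, Category.assoc, Category.assoc, pullback.lift_snd, baseChange_hom_comp_snd]

lemma isPullback_baseChange :
    IsPullback (pullback.fst P.toBase g) ((P.baseChange g).hom ≫ pullback.fst _ _)
      (P.hom ≫ pullback.fst _ _) g := by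
  rw [baseChange_hom_comp_fst]
  exact IsPullback.of_hasPullback _ _

lemma isPullback_baseChange_hom :
    IsPullback (pullback.fst P.toBase g) (P.baseChange g).hom P.hom (projSpaceMap g) :=
  IsPullback.of_bot (isPullback_baseChange g P) (fst_comp_hom_eq g P) (isPullback_projSpaceMap g)

end Fiber

section Separated

lemma isSchemeTheoreticallyDominant_toImage {X Y : Scheme.{u}} (f : X ⟶ Y) [QuasiCompact f] :
    IsSchemeTheoreticallyDominant f.toImage := by
  refine ⟨Scheme.IdealSheafData.ext_of_iSup_eq_top
    (fun U : Y.affineOpens ↦ ⟨f.imageι ⁻¹ᵁ U.1, U.2.preimage f.imageι⟩)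
    (f.imageι.iSup_preimage_eq_top (iSup_affineOpens_eq_top Y)) fun U ↦ ?_⟩
  rw [Scheme.Hom.ker_apply, Scheme.IdealSheafData.ideal_bot]
  exact (RingHom.injective_iff_ker_eq_bot _).1 (f.toImage_app_injective U)

variable {n : ℕ} {p : Polynomial ℤ} {R : Type u} [CommRing R] [IsDomain R]
  [IsDiscreteValuationRing R] {K : Type u} [Field K] [Algebra R K] [IsFractionRing R K]

/-- Let `(C, i)` and `(C', i')` be families over a discrete valuation ring and `m : C_K ⟶ C'` a
morphism over `ℙⁿ`. Then pulling back along `m` maps `i'_* 𝒪_{C'}` to `i_* 𝒪_C`. -/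
lemma IsCMFamily.appLE_mem_range {P Q : Pair n (Spec (CommRingCat.of R))} (hP : IsCMFamily p P)
    (hQ : IsCMFamily p Q) {E : Scheme.{u}} {l : E ⟶ P.left} {r : E ⟶ Spec (CommRingCat.of K)}
    (hK : IsPullback l r P.toBase (Spec.map (CommRingCat.ofHom (algebraMap R K))))
    (m : E ⟶ Q.left) (hm : m ≫ Q.hom = l ≫ P.hom)
    {U : (projSpace n (Spec (CommRingCat.of R))).Opens} (hU : IsAffineOpen U)
    (hle : l ⁻¹ᵁ P.hom ⁻¹ᵁ U ≤ m ⁻¹ᵁ Q.hom ⁻¹ᵁ U) (a : Γ(Q.left, Q.hom ⁻¹ᵁ U)) :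
    m.appLE (Q.hom ⁻¹ᵁ U) (l ⁻¹ᵁ P.hom ⁻¹ᵁ U) hle a ∈ (l.app (P.hom ⁻¹ᵁ U)).hom.range := by
  obtain ⟨π, hπ⟩ := IsDiscreteValuationRing.exists_irreducible R
  have hPf := hP.finite
  have hQf := hQ.finite
  have hPflat : Flat P.toBase := hP.flat
  let s := specClosedPoint R
  let g := (Spec (CommRingCat.of R)).fromSpecResidueField s
  have hgs : Function.Surjective g.appTop := g.app_surjective ⊤ (isAffineOpen_top _)
  have hgk := ker_appTop_fromSpecResidueField hπ
  have hPff : IsFinite (P.fiber s).hom :=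
    MorphismProperty.of_isPullback (isPullback_baseChange_hom g P) hPf
  have hQff : IsFinite (Q.fiber s).hom :=
    MorphismProperty.of_isPullback (isPullback_baseChange_hom g Q) hQf
  have hV : IsAffineOpen (P.hom ⁻¹ᵁ U) := hU.preimage P.hom
  have hcomm (x : Γ(projSpace n (Spec (CommRingCat.of R)), U)) :
      l.app (P.hom ⁻¹ᵁ U) (P.hom.app U x) = m.appLE (Q.hom ⁻¹ᵁ U) _ hle (Q.hom.app U x) := by
    have h : P.hom.app U ≫ l.app (P.hom ⁻¹ᵁ U) = Q.hom.app U ≫ m.appLE (Q.hom ⁻¹ᵁ U) _ hle := by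
      rw [Scheme.Hom.app_eq_appLE, Scheme.Hom.app_eq_appLE, Scheme.Hom.app_eq_appLE,
        Scheme.Hom.appLE_comp_appLE, Scheme.Hom.appLE_comp_appLE]
      congr 1
      exact hm.symm
    exact congr(($h).hom x)
  have hunit : IsUnit (l.app (P.hom ⁻¹ᵁ U)
      (P.toBase.appLE ⊤ (P.hom ⁻¹ᵁ U) le_top (specFunction π))) := by
    have hw := (isPushout_app_of_isPullback hK hV).w
    have h := (isUnit_appTop R K hπ.ne_zero).map (r.appLE ⊤ (l ⁻¹ᵁ P.hom ⁻¹ᵁ U) le_top).hom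
    have hw' := congr(($hw).hom (specFunction π))
    exact hw' ▸ h
  obtain ⟨k, c, hc⟩ := exists_pow_mul_eq_app_of_isPullback hK (exists_pow_mul_eq_appTop R K hπ) hV
    (m.appLE (Q.hom ⁻¹ᵁ U) _ hle a)
  refine mem_range_app_of_specialFiber hgs hgk (fst_comp_hom_eq g P) (isPullback_baseChange g P)
    (hP.cohenMacaulay s) (hP.pureDimension s) hU (l.app (P.hom ⁻¹ᵁ U)).hom
    (app_injective_of_isPullback hK (appTop_injective R K) hV) hunit _ (fun z hz hzc ↦ ?_) k
    ⟨c, hc⟩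
  obtain ⟨t, ht, x, hx⟩ := exists_mul_eq_of_specialFiber (i := Q.hom) hgs hgk
    (isPullback_projSpaceMap g).w (fst_comp_hom_eq g Q) (isPullback_baseChange g Q)
    (hQ.isoOntoImage s) hU hz hzc a
  refine ⟨t, ht, P.hom.app U x, ?_⟩
  refine Eq.trans ?_ (hcomm x).symm
  rw [← hx, map_mul]
  congr 1
  exact hcomm t

lemma IsCMFamily.isIso_of_graph {P Q : Pair n (Spec (CommRingCat.of R))} (hP : IsCMFamily p P)
    (hQ : IsCMFamily p Q) {D : Scheme.{u}} (q : D ⟶ P.left) (q' : D ⟶ Q.left)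
    (w : q ≫ P.hom = q' ≫ Q.hom) [IsClosedImmersion (pullback.lift q q' w)]
    (e : pullback P.toBase (Spec.map (CommRingCat.ofHom (algebraMap R K))) ⟶ D)
    [IsSchemeTheoreticallyDominant e] [QuasiCompact e] (he : e ≫ q = pullback.fst _ _) :
    IsIso q := by
  have hPf := hP.finite
  have hQf := hQ.finite
  have hPflat : Flat P.toBase := hP.flat
  refine isIso_of_range_le w e he (fun U _ ↦ e.app_injective _)
    (fun U hU ↦ ?_) (fun U hU hle a ↦ ?_)
  · exact app_injective_of_isPullback (IsPullback.of_hasPullback P.toBase _)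
      (appTop_injective R K) (hU.preimage P.hom)
  · exact hP.appLE_mem_range hQ (IsPullback.of_hasPullback P.toBase _) (e ≫ q')
      (by rw [Category.assoc, ← w, reassoc_of% he]) hU hle a

/-- Families over a discrete valuation ring with isomorphic generic fibers are isomorphic. -/
lemma IsCMFamily.nonempty_iso {P Q : Pair n (Spec (CommRingCat.of R))} (hP : IsCMFamily p P)
    (hQ : IsCMFamily p Q)
    (β : P.baseChange (Spec.map (CommRingCat.ofHom (algebraMap R K))) ≅
      Q.baseChange (Spec.map (CommRingCat.ofHom (algebraMap R K)))) : Nonempty (P ≅ Q) := by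
  set f := Spec.map (CommRingCat.ofHom (algebraMap R K))
  have hPf := hP.finite
  have hQf := hQ.finite
  let b : pullback P.toBase f ≅ pullback Q.toBase f := (Over.forget _).mapIso β
  have hb : b.hom ≫ (Q.baseChange f).hom = (P.baseChange f).hom := Over.w β.hom
  have hw : pullback.fst P.toBase f ≫ P.hom = (b.hom ≫ pullback.fst Q.toBase f) ≫ Q.hom := by
    rw [Category.assoc, fst_comp_hom_eq, fst_comp_hom_eq, reassoc_of% hb]
  let γ : pullback P.toBase f ⟶ pullback P.hom Q.hom := pullback.lift _ _ hw
  have hγ : QuasiCompact γ := by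
    have hsep : IsAffineHom (pullback.fst P.hom Q.hom) := MorphismProperty.of_isPullback
      (IsPullback.of_hasPullback P.hom Q.hom).flip (inferInstanceAs (IsAffineHom Q.hom))
    have hfst : IsAffineHom (pullback.fst P.toBase f) := MorphismProperty.of_isPullback
      (IsPullback.of_hasPullback P.toBase f).flip (inferInstanceAs (IsAffineHom f))
    have hcomp : QuasiCompact (γ ≫ pullback.fst P.hom Q.hom) := by
      rw [pullback.lift_fst]; infer_instance
    exact .of_comp γ (pullback.fst P.hom Q.hom)
  let q : γ.image ⟶ P.left := γ.imageι ≫ pullback.fst _ _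
  let q' : γ.image ⟶ Q.left := γ.imageι ≫ pullback.snd _ _
  have w : q ≫ P.hom = q' ≫ Q.hom := by
    simp only [q, q', Category.assoc, pullback.condition]
  have hdom := isSchemeTheoreticallyDominant_toImage γ
  have hcl : IsClosedImmersion (pullback.lift q q' w) := by
    have : pullback.lift q q' w = γ.imageι := by
      apply pullback.hom_ext
      · exact pullback.lift_fst _ _ _
      · exact pullback.lift_snd _ _ _
    rw [this]; infer_instance
  have hcl' : IsClosedImmersion (pullback.lift q' q w.symm) := by
    have : pullback.lift q' q w.symm = γ.imageι ≫ (pullbackSymmetry _ _).hom := by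
      apply pullback.hom_ext
      · rw [pullback.lift_fst, Category.assoc, pullbackSymmetry_hom_comp_fst]
      · rw [pullback.lift_snd, Category.assoc, pullbackSymmetry_hom_comp_snd]
    rw [this]; infer_instance
  have h1 : IsIso q := hP.isIso_of_graph hQ q q' w γ.toImage
    (by rw [Scheme.Hom.toImage_imageι_assoc]; exact pullback.lift_fst _ _ _)
  have h2 : IsIso q' := hQ.isIso_of_graph hP q' q w.symm (b.inv ≫ γ.toImage)
    (by rw [Category.assoc, Scheme.Hom.toImage_imageι_assoc, pullback.lift_snd, b.inv_hom_id_assoc])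
  refine ⟨Over.isoMk ((asIso q).symm ≪≫ asIso q') ?_⟩
  simp [← w]

end Separated

end CMCurve

end

theorem mainTheorem3 (n : ℕ) (p : Polynomial ℤ) (hp : p.degree = 1)
    (R : Type u) [CommRing R] [IsDomain R] [IsDiscreteValuationRing R]
    (K : Type u) [Field K] [Algebra R K] [IsFractionRing R K] :
    Set.InjOn
      (CMCurve.PairClass.baseChange (n := n)
        (Spec.map (CommRingCat.ofHom (algebraMap R K))))
      (CMCurve.CM n p (Spec (CommRingCat.of R))) := by
  rintro _ ⟨P, hP, rfl⟩ _ ⟨Q, hQ, rfl⟩ h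
  obtain ⟨β⟩ := Quotient.exact h
  exact Quotient.sound (hP.nonempty_iso hQ β)
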